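/- **Setting.** Let $V:\mathbb R^n\to\mathbb R$ be differentiable with $\int e^{-V}<\infty$, let $\mu(dx)=Z^{-1}e^{-V(x)}dx$, and let $\sigma>0$. The Metropolis adjusted Langevin algorithm (MALA) with step $\sigma$ proposes, from $x$, a point $y\sim N\big(x-\tfrac{\sigma^2}{2}\nabla V(x),\sigma^2 I\big)$, with density $q(x\to y)$, and accepts it with probability $F(R(x,y))$ (otherwise it stays at $x$), where $$R(x,y)=V(x)-V(y)+\log\frac{q(y\to x)}{q(x\to y)}$$ and $F$ is either the Metropolis rule $F(r)=\min(1,e^r)$ or the Barker rule $F(r)=(1+e^{-r})^{-1}$. Let $\mathcal T_{\rm MALA}$ be the transition operator on $L^2(\mu)$, with spectrum $\sigma(\mathcal T_{\rm MALA})$, and let $\mathrm{Gap}(\mathcal T_{\rm MALA})=1-\sup\{\lambda:\lambda\in\sigma(\mathcal T_{\rm MALA})\setminus\{1\}\}$. **Theorem 2.10.** Let $n\ge 1$, $p\ge 1$ and $C_p>0$. There is a constant $\kappa>0$, depending only on $n$, $p$ and $C_p$, such that the following holds for both acceptance rules. Assume that 1. $V_0:\mathbb R^n\to\mathbb R$ is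 continuously differentiable and $V_0(x)\ge V_{\min}+C_p\sum_{i=1}^n|x_i|^p$ for all $x$, for some $V_{\min}\in\mathbb R$; 2. $|\nabla V_0(x)|\le D_0+D_1|x|^\delta$ for all $x$, for some constants $D_0,D_1$ and some $\delta>0$; 3. $V_1(x)=\sum_{i=1}^n A_i\cos\!\big(\tfrac{x_i}{\ell_i\epsilon}\big)$ with $0<\underline A\le|A_i|\le\overline A<\infty$ and $0<\underline\ell\le\ell_i\le\overline\ell<\infty$ for all $i$; 4. $\alpha\ge0$, $\gamma>0$ and $\theta\in\mathbb R$ satisfy $2\alpha+\delta\gamma+\theta<1$. Consider MALA for the potential $V=V_0+V_1$ with $\sigma=\epsilon^\alpha$. Then there are constants $C>0$ and $\epsilon_0>0$, independent of $\epsilon$ and depending on the $A_i$ and $\ell_i$ only through the bounds $\underline A,\overline A,\underline\ell,\overline\ell$, such that for all $0<\epsilon<\epsilon_0$ $$\mathrm{Gap}(\mathcal T_{\rm MALA})\le C\Big(e^{-\frac12\kappa\,\epsilon^{-\gamma p}}+e^{-\frac1{32}\epsilon^{-2(1-\alpha-\theta)}}+\epsilon^{\,n(2\theta-\alpha)}\Big).$$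 In particular, if $\alpha<2\theta$, then for fixed $A_i$ and $\ell_i$, $\mathrm{Gap}(\mathcal T_{\rm MALA})\to0$ as $\epsilon\to0^+$. -/

import Mathlib

open MeasureTheory ProbabilityTheory
open scoped ENNReal Topology

noncomputable section

/-! ### The transition operator of a Markov kernel on complex `L²` of an invariant measure -/

section TransitionOperator

variable {X : Type*} [MeasurableSpace X] {κ : Kernel X X} {μ : Measure X}

theorem ae_ae_of_invariant (h : κ.Invariant μ) {P : X → Prop} (hP : ∀ᵐ y ∂μ, P y) :
    ∀ᵐ x ∂μ, ∀ᵐ y ∂κ x, P y := by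
  have h' : μ.bind κ = μ := h
  rw [← h'] at hP
  exact Measure.ae_ae_of_ae_bind κ.measurable.aemeasurable hP

theorem lintegral_of_invariant (h : κ.Invariant μ) {g : X → ℝ≥0∞} (hg : Measurable g) :
    ∫⁻ x, ∫⁻ y, g y ∂κ x ∂μ = ∫⁻ x, g x ∂μ := by
  have h' : μ.bind κ = μ := h
  conv_rhs => rw [← h']
  rw [Measure.lintegral_bind κ.measurable.aemeasurable hg.aemeasurable]

theorem eLpNorm_two_sq {ν : Measure X} (g : X → ℂ) :
    eLpNorm g 2 ν ^ 2 = ∫⁻ x, ‖g x‖ₑ ^ 2 ∂ν := by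
  have := eLpNorm_nnreal_pow_eq_lintegral (μ := ν) (f := g) (p := 2) (by norm_num)
  simpa using this

theorem eLpNorm_integral_kernel_le [IsMarkovKernel κ] (h : κ.Invariant μ) {f : X → ℂ} (hf : StronglyMeasurable f) :
    eLpNorm (fun x => ∫ y, f y ∂κ x) 2 μ ≤ eLpNorm f 2 μ := by
  have key : eLpNorm (fun x => ∫ y, f y ∂κ x) 2 μ ^ 2 ≤ eLpNorm f 2 μ ^ 2 := by
    rw [eLpNorm_two_sq, eLpNorm_two_sq,
      ← lintegral_of_invariant h (g := fun y => ‖f y‖ₑ ^ 2) (by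
        exact (hf.measurable.enorm).pow_const 2)]
    refine lintegral_mono fun x => ?_
    rw [← eLpNorm_two_sq]
    have h1 : ‖∫ y, f y ∂κ x‖ₑ ≤ eLpNorm f 1 (κ x) := by
      rw [eLpNorm_one_eq_lintegral_enorm]
      exact enorm_integral_le_lintegral_enorm _
    have h2 : eLpNorm f 1 (κ x) ≤ eLpNorm f 2 (κ x) :=
      eLpNorm_le_eLpNorm_of_exponent_le (by norm_num) hf.aestronglyMeasurable
    exact pow_le_pow_left' (h1.trans h2) 2
  exact (ENNReal.pow_le_pow_left_iff (by norm_num)).1 key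

theorem memLp_integral_kernel [IsMarkovKernel κ] (h : κ.Invariant μ) (f : Lp ℂ 2 μ) :
    MemLp (fun x => ∫ y, f y ∂κ x) 2 μ :=
  ⟨(Lp.stronglyMeasurable f).integral_kernel.aestronglyMeasurable,
    (eLpNorm_integral_kernel_le h (Lp.stronglyMeasurable f)).trans_lt (Lp.eLpNorm_lt_top f)⟩

theorem ae_integrable_kernel [IsMarkovKernel κ] (h : κ.Invariant μ) (f : Lp ℂ 2 μ) :
    ∀ᵐ x ∂μ, Integrable (fun y => f y) (κ x) := by
  have hf := Lp.stronglyMeasurable f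
  have hfin : ∫⁻ x, ∫⁻ y, ‖f y‖ₑ ^ 2 ∂κ x ∂μ ≠ ∞ := by
    rw [lintegral_of_invariant h (g := fun y => ‖f y‖ₑ ^ 2) (by
      exact (hf.measurable.enorm).pow_const 2), ← eLpNorm_two_sq]
    exact ENNReal.pow_ne_top (Lp.eLpNorm_lt_top f).ne
  have hm : Measurable fun x => ∫⁻ y, ‖f y‖ₑ ^ 2 ∂κ x :=
    Measurable.lintegral_kernel (by exact (hf.measurable.enorm).pow_const 2)
  filter_upwards [ae_lt_top hm hfin] with x hx
  have : MemLp (fun y => f y) 2 (κ x) := by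
    refine ⟨hf.aestronglyMeasurable, ?_⟩
    rw [← eLpNorm_two_sq] at hx
    by_contra hc
    rw [not_lt, top_le_iff] at hc
    rw [hc] at hx
    simp at hx
  exact this.integrable (by norm_num)

/-- The transition operator `(T f)(x) = ∫ f(y) κ(x, dy)` of a Markov kernel `κ`, as a bounded
operator on the complex Hilbert space `L²(μ)` of an invariant measure `μ`. -/
def transitionOperator (κ : Kernel X X) [IsMarkovKernel κ] (μ : Measure X)
    (h : κ.Invariant μ) : Lp ℂ 2 μ →L[ℂ] Lp ℂ 2 μ :=
  LinearMap.mkContinuous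
    { toFun := fun f => (memLp_integral_kernel h f).toLp (fun x => ∫ y, f y ∂κ x)
      map_add' := by
        intro f g
        rw [← MemLp.toLp_add, MemLp.toLp_eq_toLp_iff]
        filter_upwards [ae_ae_of_invariant h (Lp.coeFn_add f g), ae_integrable_kernel h f,
          ae_integrable_kernel h g] with x hx hf hg
        rw [integral_congr_ae hx]
        simpa using integral_add hf hg
      map_smul' := by
        intro c f
        rw [RingHom.id_apply, ← MemLp.toLp_const_smul, MemLp.toLp_eq_toLp_iff]
        filter_upwards [ae_ae_of_invariant h (Lp.coeFn_smul c f)] with x hx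
        rw [integral_congr_ae hx]
        simpa using integral_const_mul c (fun y => f y) }
    1 (by
      intro f
      rw [one_mul, Lp.norm_def, Lp.norm_def]
      refine ENNReal.toReal_mono (Lp.eLpNorm_lt_top f).ne ?_
      refine (eLpNorm_congr_ae (MemLp.coeFn_toLp (memLp_integral_kernel h f))).trans_le ?_
      exact eLpNorm_integral_kernel_le h (Lp.stronglyMeasurable f))

end TransitionOperator

/-- The spectral gap `1 - sup {Re z | z ∈ σ(T), z ≠ 1}` of a bounded operator. The transition
operators below are self-adjoint, so that their spectrum is real. -/
def spectralGap {H : Type*} [NormedAddCommGroup H] [NormedSpace ℂ H] (T : H →L[ℂ] H) : ℝ :=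
  1 - sSup (Complex.re '' (spectrum ℂ T \ {1}))

/-! ### The Metropolis adjusted Langevin algorithm -/

/-- The acceptance rules. -/
inductive AcceptanceRule
  | metropolis
  | barker

/-- The acceptance probability as a function of the logarithmic ratio `r`. -/
def AcceptanceRule.prob : AcceptanceRule → ℝ → ℝ
  | .metropolis, r => min 1 (Real.exp r)
  | .barker, r => (1 + Real.exp (-r))⁻¹

section MALA

variable {n : ℕ}

/-- The Boltzmann distribution `Z⁻¹ exp(-V(x)) dx`. -/
def boltzmann (V : EuclideanSpace ℝ (Fin n) → ℝ) : Measure (EuclideanSpace ℝ (Fin n)) :=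
  (volume : Measure (EuclideanSpace ℝ (Fin n))).tilted (fun x => -V x)

/-- The density at `y` of the proposal `N(x - (σ²/2) ∇V(x), σ² I)`. -/
def malaProposal (V : EuclideanSpace ℝ (Fin n) → ℝ) (σ : ℝ)
    (x y : EuclideanSpace ℝ (Fin n)) : ℝ :=
  (2 * Real.pi * σ ^ 2) ^ (-(n : ℝ) / 2) *
    Real.exp (-‖y - (x - (σ ^ 2 / 2) • gradient V x)‖ ^ 2 / (2 * σ ^ 2))

/-- `R(x, y) = V(x) - V(y) + log (q(y → x) / q(x → y))`. -/
def malaLogRatio (V : EuclideanSpace ℝ (Fin n) → ℝ) (σ : ℝ)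
    (x y : EuclideanSpace ℝ (Fin n)) : ℝ :=
  V x - V y + Real.log (malaProposal V σ y x / malaProposal V σ x y)

/-- The density of accepted moves, `F(R(x, y)) q(x → y)`. -/
def malaAccept (F : AcceptanceRule) (V : EuclideanSpace ℝ (Fin n) → ℝ) (σ : ℝ)
    (x y : EuclideanSpace ℝ (Fin n)) : ℝ≥0∞ :=
  ENNReal.ofReal (F.prob (malaLogRatio V σ x y) * malaProposal V σ x y)

theorem AcceptanceRule.measurable_prob (F : AcceptanceRule) : Measurable F.prob := by
  cases F
  · show Measurable fun r => min 1 (Real.exp r)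
    fun_prop
  · show Measurable fun r => (1 + Real.exp (-r))⁻¹
    fun_prop

theorem AcceptanceRule.prob_nonneg (F : AcceptanceRule) (r : ℝ) : 0 ≤ F.prob r := by
  cases F
  · exact le_min zero_le_one (Real.exp_pos r).le
  · show 0 ≤ (1 + Real.exp (-r))⁻¹
    positivity

theorem AcceptanceRule.prob_le_one (F : AcceptanceRule) (r : ℝ) : F.prob r ≤ 1 := by
  cases F
  · exact min_le_left _ _
  · exact inv_le_one_of_one_le₀ (by linarith [Real.exp_pos (-r)])

theorem AcceptanceRule.prob_balance (F : AcceptanceRule) (r : ℝ) :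
    F.prob r = Real.exp r * F.prob (-r) := by
  cases F
  · show min 1 (Real.exp r) = Real.exp r * min 1 (Real.exp (-r))
    rw [mul_min_of_nonneg _ _ (Real.exp_pos r).le, ← Real.exp_add, min_comm]
    simp
  · show (1 + Real.exp (-r))⁻¹ = Real.exp r * (1 + Real.exp (-(-r)))⁻¹
    rw [neg_neg, Real.exp_neg]
    have := Real.exp_pos r
    field_simp
    ring

theorem malaProposal_nonneg (V : EuclideanSpace ℝ (Fin n) → ℝ) (σ : ℝ)
    (x y : EuclideanSpace ℝ (Fin n)) : 0 ≤ malaProposal V σ x y := by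
  unfold malaProposal
  positivity

theorem measurable_gradient (V : EuclideanSpace ℝ (Fin n) → ℝ) : Measurable (gradient V) :=
  (LinearIsometryEquiv.continuous _).measurable.comp (measurable_fderiv ℝ V)

theorem measurable_malaProposal (V : EuclideanSpace ℝ (Fin n) → ℝ) (σ : ℝ) :
    Measurable fun z : EuclideanSpace ℝ (Fin n) × EuclideanSpace ℝ (Fin n) =>
      malaProposal V σ z.1 z.2 := by
  have h : Measurable fun z : EuclideanSpace ℝ (Fin n) × EuclideanSpace ℝ (Fin n) =>
    gradient V z.1 := (measurable_gradient V).comp measurable_fst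
  unfold malaProposal
  fun_prop

theorem measurable_malaAccept (F : AcceptanceRule) {V : EuclideanSpace ℝ (Fin n) → ℝ}
    (hV : Measurable V) (σ : ℝ) :
    Measurable fun z : EuclideanSpace ℝ (Fin n) × EuclideanSpace ℝ (Fin n) =>
      malaAccept F V σ z.1 z.2 := by
  have h1 := measurable_malaProposal V σ
  have h2 : Measurable fun z : EuclideanSpace ℝ (Fin n) × EuclideanSpace ℝ (Fin n) =>
      malaProposal V σ z.2 z.1 := by
    have := h1.comp measurable_swap
    simpa only [Function.comp_def, Prod.fst_swap, Prod.snd_swap] using this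
  have hV1 : Measurable fun z : EuclideanSpace ℝ (Fin n) × EuclideanSpace ℝ (Fin n) => V z.1 :=
    hV.comp measurable_fst
  have hV2 : Measurable fun z : EuclideanSpace ℝ (Fin n) × EuclideanSpace ℝ (Fin n) => V z.2 :=
    hV.comp measurable_snd
  have h3 : Measurable fun z : EuclideanSpace ℝ (Fin n) × EuclideanSpace ℝ (Fin n) =>
      malaLogRatio V σ z.1 z.2 := by
    unfold malaLogRatio
    exact (hV1.sub hV2).add (Measurable.log (h2.div h1))
  have h4 : Measurable fun z : EuclideanSpace ℝ (Fin n) × EuclideanSpace ℝ (Fin n) =>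
      F.prob (malaLogRatio V σ z.1 z.2) := F.measurable_prob.comp h3
  unfold malaAccept
  exact (h4.mul h1).ennreal_ofReal

theorem lintegral_malaProposal_le (V : EuclideanSpace ℝ (Fin n) → ℝ) (σ : ℝ)
    (x : EuclideanSpace ℝ (Fin n)) :
    ∫⁻ y, ENNReal.ofReal (malaProposal V σ x y) ≤ 1 := by
  have gauss : ∀ (b : ℝ) (c : EuclideanSpace ℝ (Fin n)), 0 < b →
      ∫⁻ y, ENNReal.ofReal (Real.exp (-b * ‖y - c‖ ^ 2)) =
        ENNReal.ofReal ((Real.pi / b) ^ ((n : ℝ) / 2)) := by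
    intro b c hb
    rw [lintegral_sub_right_eq_self
      (fun y : EuclideanSpace ℝ (Fin n) => ENNReal.ofReal (Real.exp (-b * ‖y‖ ^ 2))) c]
    have hI := GaussianFourier.integral_rexp_neg_mul_sq_norm
      (V := EuclideanSpace ℝ (Fin n)) hb
    have hpos : (0 : ℝ) < (Real.pi / b) ^
        ((Module.finrank ℝ (EuclideanSpace ℝ (Fin n)) : ℝ) / 2) := by positivity
    rw [← ofReal_integral_eq_lintegral_ofReal, hI]
    · simp
    · by_contra hc
      rw [integral_undef hc] at hI
      exact hpos.ne hI
    · exact Filter.Eventually.of_forall fun y => (Real.exp_pos _).le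
  rcases eq_or_ne σ 0 with rfl | hσ
  · rcases Nat.eq_zero_or_pos n with rfl | hn
    · have h := gauss 1 0 one_pos
      have : ∀ y : EuclideanSpace ℝ (Fin 0), malaProposal V 0 x y =
          Real.exp (-1 * ‖y - 0‖ ^ 2) := by
        intro y
        have hy : y = 0 := Subsingleton.elim _ _
        subst hy
        simp [malaProposal]
      simp_rw [this, h]
      simp
    · have : ∀ y, malaProposal V 0 x y = 0 := by
        intro y
        have : (-(n : ℝ) / 2) ≠ 0 := by
          have : (0 : ℝ) < n := by exact_mod_cast hn
          linarith
        simp [malaProposal, Real.zero_rpow this]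
      simp [this]
  · have hs : 0 < σ ^ 2 := by positivity
    set m := x - (σ ^ 2 / 2) • gradient V x with hm
    have : ∀ y, ENNReal.ofReal (malaProposal V σ x y) =
        ENNReal.ofReal ((2 * Real.pi * σ ^ 2) ^ (-(n : ℝ) / 2)) *
          ENNReal.ofReal (Real.exp (-(1 / (2 * σ ^ 2)) * ‖y - m‖ ^ 2)) := by
      intro y
      rw [← ENNReal.ofReal_mul (by positivity), malaProposal, ← hm]
      congr 3
      field_simp
    simp_rw [this]
    rw [lintegral_const_mul _ (by fun_prop), gauss _ _ (by positivity),
      ← ENNReal.ofReal_mul (by positivity)]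
    have e : Real.pi / (1 / (2 * σ ^ 2)) = 2 * Real.pi * σ ^ 2 := by
      field_simp
    rw [e, ← Real.rpow_add (by positivity)]
    have : -(n : ℝ) / 2 + (n : ℝ) / 2 = 0 := by ring
    simp [this]

theorem lintegral_malaAccept_le (F : AcceptanceRule) (V : EuclideanSpace ℝ (Fin n) → ℝ) (σ : ℝ)
    (x : EuclideanSpace ℝ (Fin n)) : ∫⁻ y, malaAccept F V σ x y ≤ 1 := by
  refine (lintegral_mono fun y => ?_).trans (lintegral_malaProposal_le V σ x)
  exact ENNReal.ofReal_le_ofReal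
    (mul_le_of_le_one_left (malaProposal_nonneg V σ x y) (F.prob_le_one _))

/-- The transition kernel: `F(R(x, y)) q(x → y) dy` for an accepted proposal, and the remaining
mass at `x` for a rejected one. -/
def malaKernel (F : AcceptanceRule) (V : EuclideanSpace ℝ (Fin n) → ℝ) (hV : Measurable V)
    (σ : ℝ) : Kernel (EuclideanSpace ℝ (Fin n)) (EuclideanSpace ℝ (Fin n)) where
  toFun x := (volume : Measure (EuclideanSpace ℝ (Fin n))).withDensity (malaAccept F V σ x) +
    (1 - ∫⁻ y, malaAccept F V σ x y) • Measure.dirac x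
  measurable' := by
    have hm := measurable_malaAccept F hV σ
    refine Measure.measurable_of_measurable_coe _ fun s hs => ?_
    have : ∀ x, ((volume : Measure (EuclideanSpace ℝ (Fin n))).withDensity (malaAccept F V σ x) +
        (1 - ∫⁻ y, malaAccept F V σ x y) • Measure.dirac x) s =
        (∫⁻ y in s, malaAccept F V σ x y) +
          (1 - ∫⁻ y, malaAccept F V σ x y) * s.indicator 1 x := by
      intro x
      simp [withDensity_apply _ hs, Measure.dirac_apply' _ hs]
    simp_rw [this]
    refine Measurable.add hm.lintegral_prod_right' (Measurable.mul ?_ ?_)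
    · exact measurable_const.sub hm.lintegral_prod_right'
    · exact measurable_one.indicator hs

theorem malaKernel_apply' (F : AcceptanceRule) (V : EuclideanSpace ℝ (Fin n) → ℝ)
    (hV : Measurable V) (σ : ℝ) (x : EuclideanSpace ℝ (Fin n))
    {s : Set (EuclideanSpace ℝ (Fin n))} (hs : MeasurableSet s) :
    malaKernel F V hV σ x s = (∫⁻ y in s, malaAccept F V σ x y) +
      (1 - ∫⁻ y, malaAccept F V σ x y) * s.indicator 1 x := by
  show ((volume : Measure (EuclideanSpace ℝ (Fin n))).withDensity (malaAccept F V σ x) +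
        (1 - ∫⁻ y, malaAccept F V σ x y) • Measure.dirac x) s = _
  simp [withDensity_apply _ hs, Measure.dirac_apply' _ hs]

instance isMarkovKernel_malaKernel (F : AcceptanceRule) (V : EuclideanSpace ℝ (Fin n) → ℝ)
    (hV : Measurable V) (σ : ℝ) : IsMarkovKernel (malaKernel F V hV σ) := by
  refine ⟨fun x => ⟨?_⟩⟩
  rw [malaKernel_apply' F V hV σ x MeasurableSet.univ]
  simp [add_tsub_cancel_of_le (lintegral_malaAccept_le F V σ x)]

theorem malaAccept_balance (F : AcceptanceRule) (V : EuclideanSpace ℝ (Fin n) → ℝ) (σ : ℝ)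
    (x y : EuclideanSpace ℝ (Fin n)) :
    ENNReal.ofReal (Real.exp (-V x)) * malaAccept F V σ x y =
      ENNReal.ofReal (Real.exp (-V y)) * malaAccept F V σ y x := by
  unfold malaAccept
  rw [← ENNReal.ofReal_mul (Real.exp_pos _).le, ← ENNReal.ofReal_mul (Real.exp_pos _).le]
  congr 1
  have hc : 0 ≤ (2 * Real.pi * σ ^ 2) ^ (-(n : ℝ) / 2) := by positivity
  rcases hc.eq_or_lt with h0 | hpos
  · simp [malaProposal, ← h0]
  · have q1 : 0 < malaProposal V σ x y := mul_pos hpos (Real.exp_pos _)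
    have q2 : 0 < malaProposal V σ y x := mul_pos hpos (Real.exp_pos _)
    have hneg : malaLogRatio V σ y x = -malaLogRatio V σ x y := by
      unfold malaLogRatio
      rw [Real.log_div q1.ne' q2.ne', Real.log_div q2.ne' q1.ne']
      ring
    have hexp : Real.exp (malaLogRatio V σ x y) =
        Real.exp (V x) * Real.exp (-V y) * (malaProposal V σ y x / malaProposal V σ x y) := by
      unfold malaLogRatio
      rw [Real.exp_add, Real.exp_log (div_pos q2 q1), sub_eq_add_neg, Real.exp_add]
    rw [F.prob_balance (malaLogRatio V σ x y), hneg, hexp, Real.exp_neg (V x)]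
    have := Real.exp_pos (V x)
    field_simp

theorem isReversible_malaKernel (F : AcceptanceRule) (V : EuclideanSpace ℝ (Fin n) → ℝ)
    (hV : Measurable V) (σ : ℝ) : (malaKernel F V hV σ).IsReversible (boltzmann V) := by
  intro A B hA hB
  have hm := measurable_malaAccept F hV σ
  set w : EuclideanSpace ℝ (Fin n) → ℝ≥0∞ := fun x => ENNReal.ofReal
    (Real.exp (-V x) / ∫ z, Real.exp (-V z)) with hw
  have hwm : Measurable w := by
    rw [hw]
    fun_prop
  have bal : ∀ x y, w x * malaAccept F V σ x y = w y * malaAccept F V σ y x := by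
    intro x y
    have hZ : 0 ≤ (∫ z : EuclideanSpace ℝ (Fin n), Real.exp (-V z))⁻¹ :=
      inv_nonneg.2 (integral_nonneg fun z => (Real.exp_pos _).le)
    simp only [hw, div_eq_mul_inv]
    rw [ENNReal.ofReal_mul' hZ, ENNReal.ofReal_mul' hZ, mul_right_comm,
      malaAccept_balance F V σ x y, mul_right_comm]
  have expand : ∀ {A B : Set (EuclideanSpace ℝ (Fin n))}, MeasurableSet A → MeasurableSet B →
      ∫⁻ x in A, malaKernel F V hV σ x B ∂(boltzmann V) =
        (∫⁻ x in A, ∫⁻ y in B, w x * malaAccept F V σ x y) +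
        ∫⁻ x in A ∩ B, w x * (1 - ∫⁻ y, malaAccept F V σ x y) := by
    intro A B hA hB
    rw [boltzmann, setLIntegral_tilted' _ _ hA]
    have e : ∀ x, ENNReal.ofReal (Real.exp (-V x) / ∫ z, Real.exp (-V z)) *
        malaKernel F V hV σ x B = (∫⁻ y in B, w x * malaAccept F V σ x y) +
          B.indicator (fun x => w x * (1 - ∫⁻ y, malaAccept F V σ x y)) x := by
      intro x
      rw [malaKernel_apply' F V hV σ x hB, mul_add,
        lintegral_const_mul (w x) (show Measurable (malaAccept F V σ x) from
          hm.comp measurable_prodMk_left)]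
      congr 1
      by_cases hx : x ∈ B <;> simp [hx, hw]
    simp_rw [e]
    rw [lintegral_add_left, setLIntegral_indicator hB, Set.inter_comm]
    exact ((hwm.comp measurable_fst).mul hm).lintegral_prod_right'
  rw [expand hA hB, expand hB hA, Set.inter_comm B A, lintegral_lintegral_swap]
  · congr 1
    refine lintegral_congr fun y => lintegral_congr fun x => bal x y
  · exact ((hwm.comp measurable_fst).mul hm).aemeasurable

/-- The transition operator of MALA with step `σ`, on complex `L²` of the Boltzmann distribution
of `V`. -/
def malaOperator (F : AcceptanceRule) (V : EuclideanSpace ℝ (Fin n) → ℝ) (hV : Measurable V)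
    (σ : ℝ) : Lp ℂ 2 (boltzmann V) →L[ℂ] Lp ℂ 2 (boltzmann V) :=
  transitionOperator (malaKernel F V hV σ) (boltzmann V)
    (isReversible_malaKernel F V hV σ).invariant

/-- The rough potential `V₀(x) + ∑ i, A i * cos (x i / (ℓ i * ε))`. -/
def roughPotential (V₀ : EuclideanSpace ℝ (Fin n) → ℝ) (A ℓ : Fin n → ℝ) (ε : ℝ)
    (x : EuclideanSpace ℝ (Fin n)) : ℝ :=
  V₀ x + ∑ i, A i * Real.cos (x i / (ℓ i * ε))

theorem measurable_roughPotential {V₀ : EuclideanSpace ℝ (Fin n) → ℝ} (h : ContDiff ℝ 1 V₀)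
    (A ℓ : Fin n → ℝ) (ε : ℝ) : Measurable (roughPotential V₀ A ℓ ε) := by
  have := h.continuous.measurable
  unfold roughPotential
  fun_prop

end MALA

end

open MeasureTheory ProbabilityTheory
open scoped ENNReal Topology

/-! ### Spectral gap of self-adjoint contractions. -/

section RayleighBound

variable {H : Type*} [NormedAddCommGroup H] [InnerProductSpace ℂ H] [CompleteSpace H]

/-! The gap is small because MALA gets stuck near a single bad point. Where one coordinate of the
gradient of the oscillating part is maximal, within distance of order `ε` of the origin, `‖∇V‖` is
at least `g = a / ε` with `a > 0` independent of `ε`. From there the drift throws the proposal a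
distance of order `σ² g = a ε ^ (-(1 - 2α))`. A proposal landing near the origin is then a Gaussian
rarity; one landing far away climbs a potential of at least linear growth and is rejected. So a move
is accepted with probability at most a constant times `σ ^ (-n) * exp (-c σ² g)`
(`prob_mul_malaProposal_le_exp`).

By continuity the same holds on a ball around the point, which can be taken so small that its mass
is at most `1 / 2`. The conductance bound `spectralGap_transitionOperator_le` turns the escape
probability from this ball into a bound for the gap; how small the mass is plays no role. It rests
on the Rayleigh bound `spectralGap_mul_norm_sq_le` for the centred indicator of the ball.

If `α < 2θ`, then `θ > 0`, hence `2α < 1`, and the escape probability decays faster than any power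
of `ε`. If `2θ ≤ α`, the term `ε ^ (n (2θ - α))` is at least `1` for `ε < 1`, and the trivial bound
`2` for the gap suffices. In both cases the third term alone dominates; the two exponentials are
only added as nonnegative terms. -/

theorem spectralGap_nonneg {T : H →L[ℂ] H} (hT : ‖T‖ ≤ 1) : 0 ≤ spectralGap T := by
  unfold spectralGap
  rw [sub_nonneg]
  refine Real.sSup_le ?_ zero_le_one
  rintro _ ⟨z, hz, rfl⟩
  have h1 : ‖z‖ ≤ ‖T‖ * ‖(1 : H →L[ℂ] H)‖ := spectrum.norm_le_norm_mul_of_mem hz.1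
  have h2 : ‖(1 : H →L[ℂ] H)‖ ≤ 1 := ContinuousLinearMap.norm_id_le
  calc z.re ≤ ‖z‖ := Complex.re_le_norm z
    _ ≤ 1 * 1 := h1.trans (mul_le_mul hT h2 (norm_nonneg _) zero_le_one)
    _ = 1 := one_mul 1

theorem spectralGap_le_two {T : H →L[ℂ] H} (hT : ‖T‖ ≤ 1) : spectralGap T ≤ 2 := by
  have h2 : ‖(1 : H →L[ℂ] H)‖ ≤ 1 := ContinuousLinearMap.norm_id_le
  have hn : ∀ z ∈ spectrum ℂ T, ‖z‖ ≤ 1 := fun z hz =>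
    (spectrum.norm_le_norm_mul_of_mem hz).trans (by
      simpa using mul_le_mul hT h2 (norm_nonneg _) zero_le_one)
  unfold spectralGap
  suffices h : -1 ≤ sSup (Complex.re '' (spectrum ℂ T \ {1})) by linarith
  rcases (Complex.re '' (spectrum ℂ T \ {1})).eq_empty_or_nonempty with he | ⟨_, z, hz, rfl⟩
  · rw [he, Real.sSup_empty]
    norm_num
  · have hb : BddAbove (Complex.re '' (spectrum ℂ T \ {1})) := by
      refine ⟨1, ?_⟩
      rintro _ ⟨w, hw, rfl⟩
      exact (Complex.re_le_norm w).trans (hn w hw.1)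
    refine le_trans ?_ (le_csSup hb ⟨z, hz, rfl⟩)
    have := (Complex.abs_re_le_norm z).trans (hn z hz.1)
    exact (abs_le.1 this).1

/-- The Rayleigh bound for the spectral gap of a self-adjoint contraction: if `f` is orthogonal to
all fixed vectors of `T`, then `Gap(T) ‖f‖² ≤ ⟨f, (1 - T) f⟩`. -/
theorem spectralGap_mul_norm_sq_le {T : H →L[ℂ] H} (hsa : IsSelfAdjoint T) (hT : ‖T‖ ≤ 1)
    {f : H} (hf : ∀ h, T h = h → inner ℂ h f = 0) :
    spectralGap T * ‖f‖ ^ 2 ≤ ‖f‖ ^ 2 - (inner ℂ f (T f)).re := by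
  have h2 : ‖(1 : H →L[ℂ] H)‖ ≤ 1 := ContinuousLinearMap.norm_id_le
  have hn : ∀ z ∈ spectrum ℂ T, ‖z‖ ≤ 1 := fun z hz =>
    (spectrum.norm_le_norm_mul_of_mem hz).trans (by
      simpa using mul_le_mul hT h2 (norm_nonneg _) zero_le_one)
  have hb : BddAbove (Complex.re '' (spectrum ℂ T \ {1})) := by
    refine ⟨1, ?_⟩
    rintro _ ⟨w, hw, rfl⟩
    exact (Complex.re_le_norm w).trans (hn w hw.1)
  set s := sSup (Complex.re '' (spectrum ℂ T \ {1})) with hs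
  have hgap : spectralGap T = 1 - s := rfl
  suffices h : (inner ℂ f (T f)).re ≤ s * ‖f‖ ^ 2 by
    rw [hgap]
    linarith
  -- If `s ≥ 1`, Cauchy–Schwarz and `‖T‖ ≤ 1` already give the claim. Otherwise `1` is separated
  -- from the rest of the spectrum.
  rcases le_or_gt 1 s with h1 | h1
  · have : (inner ℂ f (T f)).re ≤ ‖f‖ * ‖T f‖ :=
      (Complex.re_le_norm _).trans (norm_inner_le_norm f (T f))
    have h3 : ‖T f‖ ≤ ‖f‖ := by simpa using T.le_of_opNorm_le hT f
    nlinarith [norm_nonneg f, sq_nonneg ‖f‖]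
  have hspec : ∀ x ∈ spectrum ℝ T, x ≠ 1 → x ≤ s := by
    intro x hx hx1
    have hx' : (x : ℂ) ∈ spectrum ℂ T := by
      have := (spectrum.algebraMap_mem_iff ℂ (R := ℝ) (a := T) (r := x)).2 hx
      simpa using this
    exact le_csSup hb ⟨x, ⟨hx', by simpa using fun h => hx1 (by exact_mod_cast h)⟩, by simp⟩
  -- A continuous function that is `1` at `1` and `0` on the rest of the spectrum, so that `cfc g T`
  -- is the spectral projection onto the fixed vectors of `T`.
  let g : ℝ → ℝ := fun x => max 0 ((x - s) / (1 - s))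
  have hg : Continuous g := by fun_prop
  have hs1 : 0 < 1 - s := by linarith
  have hg1 : g 1 = 1 := by simp [g, hs1.ne']
  have hg0 : ∀ x ∈ spectrum ℝ T, x ≠ 1 → g x = 0 := by
    intro x hx hx1
    have := hspec x hx hx1
    exact max_eq_left (div_nonpos_of_nonpos_of_nonneg (by linarith) hs1.le)
  set P : H →L[ℂ] H := cfc g T with hP
  have hfix : T * P = P := by
    have e : cfc (fun x => x * g x) T = T * P := by
      rw [cfc_mul (fun x => x) g T, cfc_id' ℝ T]
    rw [← e, hP]
    refine cfc_congr fun x hx => ?_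
    rcases eq_or_ne x 1 with rfl | hx1
    · simp
    · simp [hg0 x hx hx1]
  have hPsa : IsSelfAdjoint P := IsSelfAdjoint.cfc
  -- `P (P f)` is fixed by `T`, hence orthogonal to `f`, and its inner product with `f` is `‖P f‖ ^
  -- 2`.
  have hPf : P f = 0 := by
    have h3 : inner ℂ (P (P f)) f = 0 := hf _ (by
      rw [← mul_apply_eq_comp, hfix])
    have h4 : inner ℂ (P (P f)) f = inner ℂ (P f) (P f) :=
      (ContinuousLinearMap.isSelfAdjoint_iff_isSymmetric.1 hPsa) (P f) f
    rw [h4] at h3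
    exact inner_self_eq_zero.1 h3
  -- The second summand lifts `s - x` to exactly `0` at `x = 1`, the only spectral point that may
  -- exceed `s`; it contributes nothing on `f` because `P f = 0`.
  have hpos : 0 ≤ cfc (fun x => (s - x) + (1 - s) * g x) T := by
    refine cfc_nonneg fun x hx => ?_
    rcases eq_or_ne x 1 with rfl | hx1
    · rw [hg1]
      linarith
    · rw [hg0 x hx hx1]
      linarith [hspec x hx hx1]
  have hexp : cfc (fun x => (s - x) + (1 - s) * g x) T =
      (algebraMap ℝ (H →L[ℂ] H) s - T) + (1 - s) • P := by
    rw [cfc_add T (fun x => s - x) (fun x => (1 - s) * g x), cfc_sub (a := T) (fun _ => s) (fun x => x),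
      cfc_const s T, cfc_id' ℝ T, cfc_const_mul (1 - s) g T]
  rw [hexp, ContinuousLinearMap.nonneg_iff_isPositive] at hpos
  have h5 := hpos.re_inner_nonneg_right f
  simp only [add_apply, sub_apply, Algebra.algebraMap_eq_smul_one,
    smul_apply, hPf, smul_zero, add_zero, one_apply_eq_self,
    inner_sub_right, map_sub] at h5
  have h6 : inner ℂ f ((s : ℝ) • f) = (s : ℂ) * (‖f‖ : ℂ) ^ 2 := by
    rw [← Complex.coe_smul, inner_smul_right, inner_self_eq_norm_sq_to_K]
    rfl
  rw [h6] at h5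
  have h7 : RCLike.re ((s : ℂ) * (‖f‖ : ℂ) ^ 2) = s * ‖f‖ ^ 2 := by
    rw [← Complex.ofReal_pow, ← Complex.ofReal_mul]
    exact Complex.ofReal_re _
  rw [h7] at h5
  have h8 : RCLike.re (inner ℂ f (T f)) = (inner ℂ f (T f)).re := rfl
  linarith

end RayleighBound

/-! ### Conductance bound for reversible kernels. -/

section ReversibleKernel

variable {X : Type*} [MeasurableSpace X] {κ : Kernel X X} {μ : Measure X}

theorem norm_transitionOperator_le [IsMarkovKernel κ] (h : κ.Invariant μ) :
    ‖transitionOperator κ μ h‖ ≤ 1 :=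
  LinearMap.mkContinuous_norm_le _ zero_le_one _

theorem transitionOperator_coeFn [IsMarkovKernel κ] (h : κ.Invariant μ) (f : Lp ℂ 2 μ) :
    transitionOperator κ μ h f =ᵐ[μ] fun x => ∫ y, f y ∂κ x :=
  MemLp.coeFn_toLp (memLp_integral_kernel h f)

variable [IsProbabilityMeasure μ] [IsMarkovKernel κ]

theorem measurePreserving_fst_compProd : MeasurePreserving Prod.fst (μ ⊗ₘ κ) μ :=
  ⟨measurable_fst, Measure.fst_compProd μ κ⟩

theorem measurePreserving_snd_compProd (h : κ.Invariant μ) :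
    MeasurePreserving Prod.snd (μ ⊗ₘ κ) μ :=
  ⟨measurable_snd, (Measure.snd_compProd μ κ).trans h⟩

/-- Reversibility is the symmetry of the joint law of two consecutive states, and rectangles
determine that law. -/
theorem measurePreserving_swap_compProd (h : κ.IsReversible μ) :
    MeasurePreserving Prod.swap (μ ⊗ₘ κ) (μ ⊗ₘ κ) := by
  refine ⟨measurable_swap, ?_⟩
  refine Measure.ext_prod fun {s t} hs ht => ?_
  rw [Measure.map_apply measurable_swap (hs.prod ht), Set.preimage_swap_prod,
    Measure.compProd_apply_prod ht hs, Measure.compProd_apply_prod hs ht]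
  exact h ht hs

/-- Writing the form of the operator as an integral over the joint law makes self-adjointness a swap
of variables, and puts `f(x)` and `f(y)` in one `L²` space. -/
theorem integral_compProd_inner_eq (h : κ.Invariant μ) (f g : Lp ℂ 2 μ) :
    ∫ z, inner ℂ (f z.1) (g z.2) ∂(μ ⊗ₘ κ) = inner ℂ f (transitionOperator κ μ h g) := by
  have hf : MemLp (fun z : X × X => f z.1) 2 (μ ⊗ₘ κ) :=
    (Lp.memLp f).comp_measurePreserving measurePreserving_fst_compProd
  have hg : MemLp (fun z : X × X => g z.2) 2 (μ ⊗ₘ κ) :=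
    (Lp.memLp g).comp_measurePreserving (measurePreserving_snd_compProd h)
  have hint : Integrable (fun z : X × X => inner ℂ (f z.1) (g z.2)) (μ ⊗ₘ κ) := by
    have := L2.integrable_inner (𝕜 := ℂ) hf.toLp hg.toLp
    refine this.congr ?_
    filter_upwards [hf.coeFn_toLp, hg.coeFn_toLp] with z h1 h2
    rw [h1, h2]
  rw [Measure.integral_compProd hint, L2.inner_def]
  refine integral_congr_ae ?_
  filter_upwards [transitionOperator_coeFn h g, ae_integrable_kernel h g] with x hx hgx
  rw [hx]
  simp only [RCLike.inner_apply]
  exact integral_mul_const _ _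

theorem isSelfAdjoint_transitionOperator (h : κ.IsReversible μ) :
    IsSelfAdjoint (transitionOperator κ μ h.invariant) := by
  rw [ContinuousLinearMap.isSelfAdjoint_iff_isSymmetric]
  intro f g
  change inner ℂ (transitionOperator κ μ h.invariant f) g =
    inner ℂ f (transitionOperator κ μ h.invariant g)
  rw [← inner_conj_symm, ← integral_compProd_inner_eq h.invariant g f,
    ← integral_compProd_inner_eq h.invariant f g, ← integral_conj]
  have hmp := measurePreserving_swap_compProd h
  rw [← hmp.map_eq, integral_map_of_stronglyMeasurable measurable_swap, hmp.map_eq]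
  · simp only [Prod.fst_swap, Prod.snd_swap, inner_conj_symm]
  · have h1 : StronglyMeasurable fun z : X × X => f z.2 :=
      (Lp.stronglyMeasurable f).comp_measurable measurable_snd
    have h2 : StronglyMeasurable fun z : X × X => g z.1 :=
      (Lp.stronglyMeasurable g).comp_measurable measurable_fst
    exact Complex.continuous_conj.comp_stronglyMeasurable (h2.inner (𝕜 := ℂ) h1)

/-- A fixed vector of the transition operator of a reversible kernel is constant along the
transitions. -/
theorem ae_ae_eq_of_transitionOperator_eq_self (h : κ.Invariant μ) {f : Lp ℂ 2 μ}
    (hf : transitionOperator κ μ h f = f) : ∀ᵐ x ∂μ, ∀ᵐ y ∂κ x, f x = f y := by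
  let hfst := measurePreserving_fst_compProd (μ := μ) (κ := κ)
  let hsnd := measurePreserving_snd_compProd h
  set f₁ := Lp.compMeasurePreserving Prod.fst hfst f
  set f₂ := Lp.compMeasurePreserving Prod.snd hsnd f
  have c₁ : f₁ =ᵐ[μ ⊗ₘ κ] fun z => f z.1 := Lp.coeFn_compMeasurePreserving f hfst
  have c₂ : f₂ =ᵐ[μ ⊗ₘ κ] fun z => f z.2 := Lp.coeFn_compMeasurePreserving f hsnd
  have n₁ : ‖f₁‖ = ‖f‖ := Lp.norm_compMeasurePreserving f hfst
  have n₂ : ‖f₂‖ = ‖f‖ := Lp.norm_compMeasurePreserving f hsnd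
  have hin : inner ℂ f₁ f₂ = inner ℂ f f := by
    rw [L2.inner_def, ← congrArg (inner ℂ f) hf, ← integral_compProd_inner_eq h f f]
    refine integral_congr_ae ?_
    filter_upwards [c₁, c₂] with z h1 h2
    rw [h1, h2]
  -- Both marginals of the joint law are `μ`, so this is the Dirichlet form `2‖f‖² - 2 Re ⟨f, T f⟩`,
  -- which vanishes at a fixed vector.
  have hz : ‖f₁ - f₂‖ ^ 2 = 0 := by
    rw [@norm_sub_sq ℂ, hin, n₁, n₂, inner_self_eq_norm_sq]
    ring
  have heq : f₁ = f₂ := by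
    rw [← sub_eq_zero, ← norm_eq_zero]
    exact pow_eq_zero_iff two_ne_zero |>.1 hz
  refine Measure.ae_ae_of_ae_compProd (p := fun z : X × X => f z.1 = f z.2) ?_
  filter_upwards [c₁, c₂] with z h1 h2
  rw [← h1, ← h2, heq]

/-- The conductance bound for the spectral gap of a reversible kernel whose transitions have full
support: if from every point of `S` the kernel leaves `S` with probability at most `η`, and
`μ S ≤ 1 / 2`, then the spectral gap is at most `2 η`. -/
theorem spectralGap_transitionOperator_le (h : κ.IsReversible μ) (hac : ∀ x, μ ≪ κ x)
    {S : Set X} (hS : MeasurableSet S) (hpos : 0 < μ S) (hhalf : μ.real S ≤ 1 / 2)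
    {η : ℝ} (hη : ∀ x ∈ S, (κ x).real Sᶜ ≤ η) :
    spectralGap (transitionOperator κ μ h.invariant) ≤ 2 * η := by
  set T := transitionOperator κ μ h.invariant with hT
  have hsa : IsSelfAdjoint T := isSelfAdjoint_transitionOperator h
  have hnorm : ‖T‖ ≤ 1 := norm_transitionOperator_le h.invariant
  set m := μ.real S with hm
  have hm0 : 0 < m := ENNReal.toReal_pos hpos.ne' (measure_ne_top _ _)
  set e : Lp ℂ 2 μ := indicatorConstLp 2 hS (measure_ne_top μ S) 1 with he
  set u : Lp ℂ 2 μ := indicatorConstLp 2 MeasurableSet.univ (measure_ne_top μ _) 1 with hu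
  have cu : u =ᵐ[μ] fun _ => (1 : ℂ) := by
    filter_upwards [indicatorConstLp_coeFn (p := 2) (hs := MeasurableSet.univ)
      (hμs := measure_ne_top μ _) (c := (1 : ℂ))] with x hx
    rw [hu, hx]
    simp
  have ce : e =ᵐ[μ] S.indicator fun _ => (1 : ℂ) := indicatorConstLp_coeFn
  have hTu : T u = u := by
    refine Lp.ext ?_
    filter_upwards [transitionOperator_coeFn h.invariant u, cu,
      ae_ae_of_invariant h.invariant cu] with x h1 h2 h3
    rw [h1, h2, integral_congr_ae h3]
    simp
  have iu : ∀ g : Lp ℂ 2 μ, inner ℂ u g = ∫ x, g x ∂μ := by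
    intro g
    rw [hu, L2.inner_indicatorConstLp_one]
    simp
  have ie : ∀ g : Lp ℂ 2 μ, inner ℂ e g = ∫ x in S, g x ∂μ := by
    intro g
    rw [he, L2.inner_indicatorConstLp_one]
  have iuu : inner ℂ u u = (1 : ℂ) := by
    rw [iu, integral_congr_ae cu]
    simp
  have iue : inner ℂ u e = (m : ℂ) := by
    rw [iu, integral_congr_ae ce, integral_indicator hS]
    simp [hm]
  have ieu : inner ℂ e u = (m : ℂ) := by
    rw [← inner_conj_symm, iue]
    simp
  have iee : inner ℂ e e = (m : ℂ) := by
    rw [ie, setIntegral_congr_ae (g := fun _ => (1 : ℂ)) hS]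
    · simp [hm]
    · filter_upwards [ce] with x hx hxS
      simp [hx, hxS]
  have iuTe : inner ℂ u (T e) = (m : ℂ) := by
    have : inner ℂ (T u) e = inner ℂ u (T e) :=
      (ContinuousLinearMap.isSelfAdjoint_iff_isSymmetric.1 hsa) u e
    rw [← this, hTu, iue]
  have ieTe : (inner ℂ e (T e)).re ≥ (1 - η) * m := by
    have hc : ∀ᵐ x ∂μ, (T e) x = (((κ x).real S : ℝ) : ℂ) := by
      filter_upwards [transitionOperator_coeFn h.invariant e,
        ae_ae_of_invariant h.invariant ce] with x h1 h3
      rw [h1, integral_congr_ae h3, integral_indicator hS]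
      simp
    have hmeas : Measurable fun x => (κ x).real S := (κ.measurable_coe hS).ennreal_toReal
    have hint : Integrable (fun x => (κ x).real S) μ :=
      Integrable.of_bound hmeas.aestronglyMeasurable 1 (Filter.Eventually.of_forall fun x => by
        rw [Real.norm_of_nonneg measureReal_nonneg]
        exact measureReal_le_one)
    rw [ie, setIntegral_congr_ae (g := fun x => (((κ x).real S : ℝ) : ℂ)) hS
      (hc.mono fun x hx _ => hx), integral_complex_ofReal, Complex.ofReal_re, ge_iff_le]
    calc (1 - η) * m = ∫ x in S, (1 - η) ∂μ := by
          rw [setIntegral_const, smul_eq_mul, mul_comm]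
      _ ≤ ∫ x in S, (κ x).real S ∂μ := by
          refine setIntegral_mono_on (by simp) hint.integrableOn hS fun x hx => ?_
          have h1 := hη x hx
          rw [probReal_compl_eq_one_sub hS] at h1
          linarith
  -- Since `μ ≪ κ x`, a single good starting point `x` forces a fixed vector to equal its value at
  -- `x` almost everywhere; the centred indicator is orthogonal to constants.
  have hfix : ∀ g, T g = g → inner ℂ g (e - (m : ℂ) • u) = 0 := by
    intro g hg
    have hconst : ∃ c : ℂ, g = c • u := by
      have : (ae μ).NeBot := inferInstance
      obtain ⟨x, hx⟩ := (ae_ae_eq_of_transitionOperator_eq_self h.invariant hg).exists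
      refine ⟨g x, Lp.ext ?_⟩
      filter_upwards [(hac x).ae_le hx, cu, Lp.coeFn_smul (g x) u] with y h1 h2 h3
      rw [h3, Pi.smul_apply, h2, ← h1]
      simp
    obtain ⟨c, rfl⟩ := hconst
    rw [inner_smul_left, inner_sub_right, inner_smul_right, iue, iuu]
    simp
  have key := spectralGap_mul_norm_sq_le hsa hnorm hfix
  have hnsq : ‖e - (m : ℂ) • u‖ ^ 2 = m - m ^ 2 := by
    have h1 : inner ℂ (e - (m : ℂ) • u) (e - (m : ℂ) • u) = ((m - m ^ 2 : ℝ) : ℂ) := by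
      simp only [inner_sub_left, inner_sub_right, inner_smul_left, inner_smul_right, iee, ieu, iue,
        iuu, Complex.conj_ofReal]
      push_cast
      ring
    rw [← inner_self_eq_norm_sq (𝕜 := ℂ), h1]
    exact Complex.ofReal_re _
  have hTf : (inner ℂ (e - (m : ℂ) • u) (T (e - (m : ℂ) • u))).re =
      (inner ℂ e (T e)).re - m ^ 2 := by
    rw [map_sub, map_smul, hTu]
    simp only [inner_sub_left, inner_sub_right, inner_smul_left, inner_smul_right, ieu, iuTe,
        iuu, Complex.conj_ofReal]
    rw [← Complex.ofReal_re (m ^ 2), ← Complex.sub_re]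
    congr 1
    push_cast
    ring
  rw [hnsq, hTf] at key
  have hgap0 : 0 ≤ spectralGap T := spectralGap_nonneg hnorm
  have h1 : spectralGap T * (m - m ^ 2) ≤ η * m := by linarith
  -- `m ≤ 1 / 2` gives `m - m² ≥ m / 2`, the source of the factor `2`.
  have h2 : spectralGap T * (m / 2) ≤ spectralGap T * (m - m ^ 2) :=
    mul_le_mul_of_nonneg_left (by nlinarith) hgap0
  have h3 : spectralGap T / 2 * m ≤ η * m := by linarith
  have := le_of_mul_le_mul_right h3 hm0
  linarith

end ReversibleKernel

/-! ### Integrability of exponential tails. -/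

section ExponentialDecay

theorem integrable_exp_neg_mul_norm {E : Type*} [NormedAddCommGroup E] [NormedSpace ℝ E]
    [FiniteDimensional ℝ E] [MeasurableSpace E] [BorelSpace E] (μ : Measure E)
    [μ.IsAddHaarMeasure] {c : ℝ} (hc : 0 < c) : Integrable (fun y : E => Real.exp (-(c * ‖y‖))) μ := by
  -- One more than the dimension makes `(1 + ‖y‖) ^ (-k)` integrable; it dominates the exponential
  -- because `t ^ k / k! ≤ exp t`.
  set k := Module.finrank ℝ E + 1 with hk
  have hI : Integrable (fun y : E => (1 + ‖y‖) ^ (-(k : ℝ))) μ :=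
    integrable_one_add_norm (by rw [hk]; push_cast; linarith)
  refine (hI.const_mul (Real.exp c * (k.factorial / c ^ k))).mono' (by fun_prop)
    (Filter.Eventually.of_forall fun y => ?_)
  have h1 : 0 < 1 + ‖y‖ := by positivity
  have h2 := Real.pow_div_factorial_le_exp (c * (1 + ‖y‖)) (by positivity) k
  rw [Real.norm_of_nonneg (Real.exp_pos _).le, Real.rpow_neg h1.le, Real.rpow_natCast]
  have h3 : Real.exp (-(c * ‖y‖)) = Real.exp c * (Real.exp (c * (1 + ‖y‖)))⁻¹ := by
    rw [← Real.exp_neg, ← Real.exp_add]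
    congr 1
    ring
  rw [h3, mul_assoc]
  refine mul_le_mul_of_nonneg_left ?_ (Real.exp_pos _).le
  refine (inv_anti₀ (by positivity) h2).trans_eq ?_
  rw [mul_pow]
  field_simp

end ExponentialDecay

/-! ### Escape probabilities and the gap of MALA. -/

section MALA

variable {n : ℕ}

theorem AcceptanceRule.prob_le_exp (F : AcceptanceRule) (r : ℝ) : F.prob r ≤ Real.exp r := by
  rw [F.prob_balance]
  exact mul_le_of_le_one_right (Real.exp_pos r).le (F.prob_le_one _)

theorem AcceptanceRule.prob_pos (F : AcceptanceRule) (r : ℝ) : 0 < F.prob r := by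
  cases F
  · exact lt_min one_pos (Real.exp_pos r)
  · show 0 < (1 + Real.exp (-r))⁻¹
    positivity

theorem malaProposal_pos (V : EuclideanSpace ℝ (Fin n) → ℝ) {σ : ℝ} (hσ : 0 < σ)
    (x y : EuclideanSpace ℝ (Fin n)) : 0 < malaProposal V σ x y := by
  unfold malaProposal
  positivity

theorem malaProposal_le (V : EuclideanSpace ℝ (Fin n) → ℝ) (σ : ℝ)
    (x y : EuclideanSpace ℝ (Fin n)) :
    malaProposal V σ x y ≤ (2 * Real.pi * σ ^ 2) ^ (-(n : ℝ) / 2) := by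
  unfold malaProposal
  refine mul_le_of_le_one_right (by positivity) (Real.exp_le_one_iff.2 ?_)
  rw [neg_div]
  exact neg_nonpos.2 (by positivity)

/-- The density of accepted moves is at most `exp(V(x) - V(y)) q(y → x)`. -/
theorem prob_mul_malaProposal_le (F : AcceptanceRule) (V : EuclideanSpace ℝ (Fin n) → ℝ) {σ : ℝ}
    (hσ : 0 < σ) (x y : EuclideanSpace ℝ (Fin n)) :
    F.prob (malaLogRatio V σ x y) * malaProposal V σ x y ≤
      (2 * Real.pi * σ ^ 2) ^ (-(n : ℝ) / 2) * Real.exp (V x - V y) := by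
  have q1 := malaProposal_pos V hσ x y
  have q2 := malaProposal_pos V hσ y x
  calc F.prob (malaLogRatio V σ x y) * malaProposal V σ x y
      ≤ Real.exp (malaLogRatio V σ x y) * malaProposal V σ x y :=
        mul_le_mul_of_nonneg_right (F.prob_le_exp _) q1.le
    _ = malaProposal V σ y x * Real.exp (V x - V y) := by
        unfold malaLogRatio
        rw [Real.exp_add, Real.exp_log (div_pos q2 q1)]
        field_simp
    _ ≤ _ := mul_le_mul_of_nonneg_right (malaProposal_le V σ y x) (Real.exp_pos _).le

/-- If the drift at `x` is large and the potential grows linearly, then accepted moves from `x` are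
rare: a proposal close to the origin is far from the mean of the proposal, and a proposal far from
the origin raises the potential. -/
theorem prob_mul_malaProposal_le_exp (F : AcceptanceRule) (V : EuclideanSpace ℝ (Fin n) → ℝ)
    {σ c L g : ℝ} (hσ : 0 < σ) (hc : 0 < c) (hL : 0 ≤ L) {x : EuclideanSpace ℝ (Fin n)}
    (hV : ∀ y, V x - V y ≤ L - c * ‖y‖) (hg : g ≤ ‖gradient V x‖) (hx : ‖x‖ ≤ σ ^ 2 * g / 8)
    (hcg : 4 * c ≤ g) (y : EuclideanSpace ℝ (Fin n)) :
    F.prob (malaLogRatio V σ x y) * malaProposal V σ x y ≤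
      (2 * Real.pi * σ ^ 2) ^ (-(n : ℝ) / 2) * Real.exp (L - c * σ ^ 2 * g / 16) *
        Real.exp (-(c / 2 * ‖y‖)) := by
  have hA : 0 ≤ (2 * Real.pi * σ ^ 2) ^ (-(n : ℝ) / 2) := by positivity
  have hs : 0 < σ ^ 2 := by positivity
  have hg0 : 0 < g := by linarith
  rw [mul_assoc, ← Real.exp_add]
  -- Near case: the drift has length at least `σ² g / 2`, while `x` and `y` have norm at most `σ² g
  -- / 8`, so `y` misses the proposal mean by at least `σ² g / 4`, and the Gaussian exponent is at
  -- most `-σ² g² / 32`. Far case: half of the decay `c ‖y‖` pays for `c σ² g / 16`, the other half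
  -- is kept for integrability in `y`.
  rcases le_or_gt ‖y‖ (σ ^ 2 * g / 8) with hy | hy
  · refine (mul_le_of_le_one_left (malaProposal_nonneg V σ x y) (F.prob_le_one _)).trans ?_
    unfold malaProposal
    refine mul_le_mul_of_nonneg_left (Real.exp_le_exp.2 ?_) hA
    set w := (σ ^ 2 / 2) • gradient V x with hw
    have hwn : ‖w‖ = σ ^ 2 / 2 * ‖gradient V x‖ := by
      rw [hw, norm_smul, Real.norm_of_nonneg (by positivity)]
    have hw1 : σ ^ 2 * g / 2 ≤ ‖w‖ := by
      rw [hwn]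
      nlinarith
    have hd : σ ^ 2 * g / 4 ≤ ‖y - (x - w)‖ := by
      have h1 : ‖w‖ ≤ ‖y - (x - w)‖ + ‖x - y‖ := by
        have : w = (y - (x - w)) + (x - y) := by abel
        conv_lhs => rw [this]
        exact norm_add_le _ _
      have h2 := norm_sub_le x y
      linarith
    have hd2 : (σ ^ 2 * g / 4) ^ 2 ≤ ‖y - (x - w)‖ ^ 2 := pow_le_pow_left₀ (by positivity) hd 2
    have h3 : -‖y - (x - w)‖ ^ 2 / (2 * σ ^ 2) ≤ -(σ ^ 2 * g ^ 2 / 32) := by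
      rw [div_le_iff₀ (by positivity)]
      nlinarith
    -- `4 c ≤ g` makes the Gaussian exponent large enough to cover both `c σ² g / 16` and `c ‖y‖ /
    -- 2`.
    have h4 : c * (σ ^ 2 * g / 8) ≤ σ ^ 2 * g ^ 2 / 32 := by
      have : 0 ≤ σ ^ 2 * g * (g - 4 * c) := by
        have : 0 ≤ g - 4 * c := by linarith
        positivity
      nlinarith
    have h5 : c * ‖y‖ ≤ c * (σ ^ 2 * g / 8) := mul_le_mul_of_nonneg_left hy hc.le
    linarith
  · refine (prob_mul_malaProposal_le F V hσ x y).trans ?_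
    refine mul_le_mul_of_nonneg_left (Real.exp_le_exp.2 ?_) hA
    have h1 := hV y
    have h2 : c * (σ ^ 2 * g / 8) ≤ c * ‖y‖ := mul_le_mul_of_nonneg_left hy.le hc.le
    linarith

theorem lintegral_malaAccept_le_exp (F : AcceptanceRule) (V : EuclideanSpace ℝ (Fin n) → ℝ)
    {σ c L g : ℝ} (hσ : 0 < σ) (hc : 0 < c) (hL : 0 ≤ L) {x : EuclideanSpace ℝ (Fin n)}
    (hV : ∀ y, V x - V y ≤ L - c * ‖y‖) (hg : g ≤ ‖gradient V x‖) (hx : ‖x‖ ≤ σ ^ 2 * g / 8)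
    (hcg : 4 * c ≤ g) :
    ∫⁻ y, malaAccept F V σ x y ≤ ENNReal.ofReal
      ((2 * Real.pi * σ ^ 2) ^ (-(n : ℝ) / 2) * Real.exp (L - c * σ ^ 2 * g / 16) *
        ∫ y : EuclideanSpace ℝ (Fin n), Real.exp (-(c / 2 * ‖y‖))) := by
  rw [← integral_const_mul, ofReal_integral_eq_lintegral_ofReal]
  · exact lintegral_mono fun y => ENNReal.ofReal_le_ofReal
      (prob_mul_malaProposal_le_exp F V hσ hc hL hV hg hx hcg y)
  · exact (integrable_exp_neg_mul_norm _ (half_pos hc)).const_mul _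
  · exact Filter.Eventually.of_forall fun y => by positivity

theorem integrable_exp_neg_of_linear_growth {V : EuclideanSpace ℝ (Fin n) → ℝ} (hV : Measurable V)
    {c B : ℝ} (hc : 0 < c) (hB : ∀ y, c * ‖y‖ - B ≤ V y) :
    Integrable fun y => Real.exp (-V y) := by
  refine ((integrable_exp_neg_mul_norm volume hc).const_mul (Real.exp B)).mono' (by fun_prop)
    (Filter.Eventually.of_forall fun y => ?_)
  rw [Real.norm_of_nonneg (Real.exp_pos _).le, ← Real.exp_add]
  exact Real.exp_le_exp.2 (by linarith [hB y])

/-- The density of accepted moves is positive everywhere. This supplies the full support required by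
the conductance bound. -/
theorem absolutelyContinuous_malaKernel (F : AcceptanceRule) {V : EuclideanSpace ℝ (Fin n) → ℝ}
    (hV : Measurable V) {σ : ℝ} (hσ : 0 < σ) (x : EuclideanSpace ℝ (Fin n)) :
    volume ≪ malaKernel F V hV σ x := by
  have hm : Measurable (malaAccept F V σ x) :=
    (measurable_malaAccept F hV σ).comp measurable_prodMk_left
  have h1 : volume ≪ volume.withDensity (malaAccept F V σ x) := by
    refine withDensity_absolutelyContinuous' hm.aemeasurable (Filter.Eventually.of_forall fun y => ?_)
    unfold malaAccept
    exact (ENNReal.ofReal_pos.2 (mul_pos (F.prob_pos _) (malaProposal_pos V hσ x y))).ne'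
  exact h1.trans (Measure.absolutelyContinuous_of_le (Measure.le_add_right le_rfl))

/-- A rejected proposal stays at `x ∈ S`, so leaving `S` requires an acceptance. -/
theorem malaKernel_real_compl_le (F : AcceptanceRule) {V : EuclideanSpace ℝ (Fin n) → ℝ}
    (hV : Measurable V) (σ : ℝ) {S : Set (EuclideanSpace ℝ (Fin n))} (hS : MeasurableSet S)
    {x : EuclideanSpace ℝ (Fin n)} (hx : x ∈ S) {η : ℝ} (hη : 0 ≤ η)
    (h : ∫⁻ y, malaAccept F V σ x y ≤ ENNReal.ofReal η) :
    (malaKernel F V hV σ x).real Sᶜ ≤ η := by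
  refine ENNReal.toReal_le_of_le_ofReal hη ?_
  rw [malaKernel_apply' F V hV σ x hS.compl]
  simp only [Set.indicator_of_notMem (Set.notMem_compl_iff.2 hx), mul_zero, add_zero]
  exact (setLIntegral_le_lintegral _ _).trans h

/-- A point with a large drift bounds the spectral gap of MALA for a potential of linear growth. -/
theorem spectralGap_malaOperator_le (hn : 1 ≤ n) (F : AcceptanceRule)
    {V : EuclideanSpace ℝ (Fin n) → ℝ} (hVm : Measurable V) (hV : ContDiff ℝ 1 V)
    {σ c L B g r : ℝ} (hσ : 0 < σ) (hc : 0 < c) (hL : 0 ≤ L) (hB : ∀ y, c * ‖y‖ - B ≤ V y)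
    {x₀ : EuclideanSpace ℝ (Fin n)} (hx₀ : V x₀ + B < L) (hr : ‖x₀‖ < r) (hrg : r ≤ σ ^ 2 * g / 8)
    (hg : g < ‖gradient V x₀‖) (hcg : 4 * c ≤ g) :
    spectralGap (malaOperator F V hVm σ) ≤
      2 * ((2 * Real.pi * σ ^ 2) ^ (-(n : ℝ) / 2) * Real.exp (L - c * σ ^ 2 * g / 16) *
        ∫ y : EuclideanSpace ℝ (Fin n), Real.exp (-(c / 2 * ‖y‖))) := by
  have hI := integrable_exp_neg_of_linear_growth hVm hc hB
  have hprob : IsProbabilityMeasure (boltzmann V) := isProbabilityMeasure_tilted hI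
  have hac : boltzmann V ≪ volume := tilted_absolutelyContinuous _ _
  have hca : volume ≪ boltzmann V := absolutelyContinuous_tilted hI
  have : Nonempty (Fin n) := ⟨⟨0, hn⟩⟩
  -- Points are null in dimension `n ≥ 1`; outer regularity then gives a neighbourhood of mass below
  -- `1 / 2`.
  have hx0 : boltzmann V {x₀} < 1 / 2 := by
    rw [hac (measure_singleton x₀)]
    norm_num
  obtain ⟨U, hU, hUo, hUm⟩ := Set.exists_isOpen_lt_of_lt {x₀} (1 / 2) hx0
  have hgc : Continuous (gradient V) :=
    (LinearIsometryEquiv.continuous _).comp (hV.continuous_fderiv one_ne_zero)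
  -- The hypotheses at `x₀` are strict and `V` is `C¹`, so they persist on a ball.
  have hnhds : U ∩ {x | V x + B < L ∧ ‖x‖ < r ∧ g < ‖gradient V x‖} ∈ 𝓝 x₀ := by
    refine Filter.inter_mem (hUo.mem_nhds (hU rfl)) ?_
    refine Filter.Eventually.and ?_ (Filter.Eventually.and ?_ ?_)
    · exact (hV.continuous.add continuous_const).continuousAt.eventually_lt_const hx₀
    · exact continuous_norm.continuousAt.eventually_lt_const hr
    · exact hgc.norm.continuousAt.eventually_const_lt hg
  obtain ⟨ρ, hρ, hball⟩ := Metric.mem_nhds_iff.1 hnhds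
  have hηpos : 0 ≤ (2 * Real.pi * σ ^ 2) ^ (-(n : ℝ) / 2) * Real.exp (L - c * σ ^ 2 * g / 16) *
        ∫ y : EuclideanSpace ℝ (Fin n), Real.exp (-(c / 2 * ‖y‖)) :=
    mul_nonneg (by positivity) (integral_nonneg fun y => (Real.exp_pos _).le)
  refine spectralGap_transitionOperator_le (isReversible_malaKernel F V hVm σ)
    (fun x => hac.trans (absolutelyContinuous_malaKernel F hVm hσ x))
    (S := Metric.ball x₀ ρ) measurableSet_ball ?_ ?_ fun x hx => ?_
  · refine pos_iff_ne_zero.2 fun h => ?_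
    exact (Metric.measure_ball_pos volume x₀ hρ).ne' (hca h)
  · refine ENNReal.toReal_le_of_le_ofReal (by norm_num) ?_
    refine (measure_mono fun x hx => (hball hx).1).trans (hUm.le.trans_eq ?_)
    rw [ENNReal.ofReal_div_of_pos two_pos]
    simp
  · obtain ⟨h1, h2, h3⟩ := (hball hx).2
    exact malaKernel_real_compl_le F hVm σ measurableSet_ball hx hηpos
      (lintegral_malaAccept_le_exp F V hσ hc hL (fun y => by linarith [hB y]) h3.le
        (h2.le.trans hrg) hcg)

theorem spectralGap_malaOperator_nonneg (F : AcceptanceRule)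
    {V : EuclideanSpace ℝ (Fin n) → ℝ} (hVm : Measurable V) (σ : ℝ) :
    0 ≤ spectralGap (malaOperator F V hVm σ) :=
  spectralGap_nonneg (norm_transitionOperator_le _)

theorem spectralGap_malaOperator_le_two (F : AcceptanceRule)
    {V : EuclideanSpace ℝ (Fin n) → ℝ} (hVm : Measurable V) (σ : ℝ) :
    spectralGap (malaOperator F V hVm σ) ≤ 2 :=
  spectralGap_le_two (norm_transitionOperator_le _)

end MALA

/-! ### Growth and gradient of the rough potential. -/

section RoughPotential

variable {n : ℕ}

theorem norm_le_sum_abs (y : EuclideanSpace ℝ (Fin n)) : ‖y‖ ≤ ∑ i, |y i| := by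
  have h : y = ∑ i, y i • EuclideanSpace.basisFun (Fin n) ℝ i := by
    conv_lhs => rw [← (EuclideanSpace.basisFun (Fin n) ℝ).sum_repr y]
    simp
  conv_lhs => rw [h]
  refine (norm_sum_le _ _).trans_eq (Finset.sum_congr rfl fun i _ => ?_)
  rw [norm_smul, (EuclideanSpace.basisFun (Fin n) ℝ).norm_eq_one, mul_one, Real.norm_eq_abs]

theorem abs_sum_mul_cos_le {A : Fin n → ℝ} {Amax : ℝ} (hA : ∀ i, |A i| ≤ Amax) (w : Fin n → ℝ) :
    |∑ i, A i * Real.cos (w i)| ≤ n * Amax := by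
  calc |∑ i, A i * Real.cos (w i)| ≤ ∑ i, |A i * Real.cos (w i)| := Finset.abs_sum_le_sum_abs _ _
    _ ≤ ∑ _i : Fin n, Amax := Finset.sum_le_sum fun i _ => by
        rw [abs_mul]
        exact (mul_le_of_le_one_right (abs_nonneg _) (Real.abs_cos_le_one _)).trans (hA i)
    _ = n * Amax := by simp

theorem contDiff_roughPotential {V₀ : EuclideanSpace ℝ (Fin n) → ℝ} (hV₀ : ContDiff ℝ 1 V₀)
    (A ℓ : Fin n → ℝ) (ε : ℝ) : ContDiff ℝ 1 (roughPotential V₀ A ℓ ε) := by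
  unfold roughPotential
  refine hV₀.add (ContDiff.sum fun i _ => contDiff_const.mul (Real.contDiff_cos.comp ?_))
  exact (EuclideanSpace.proj i : EuclideanSpace ℝ (Fin n) →L[ℝ] ℝ).contDiff.div_const _

/-- For `p ≥ 1` one has `t ^ p ≥ t - 1` on `t ≥ 0`, and the cosines cost at most `n * Amax`. The
constants do not depend on `ε` or `ℓ`. -/
theorem roughPotential_ge {V₀ : EuclideanSpace ℝ (Fin n) → ℝ} {Vmin Cp p Amax : ℝ} (hp : 1 ≤ p)
    (hCp : 0 ≤ Cp) (hlow : ∀ x, Vmin + Cp * ∑ i, |x i| ^ p ≤ V₀ x) {A : Fin n → ℝ}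
    (hA : ∀ i, |A i| ≤ Amax) (ℓ : Fin n → ℝ) (ε : ℝ) (y : EuclideanSpace ℝ (Fin n)) :
    Cp * ‖y‖ - (n * Cp + n * Amax - Vmin) ≤ roughPotential V₀ A ℓ ε y := by
  have h1 : ‖y‖ - n ≤ ∑ i, |y i| ^ p := by
    calc ‖y‖ - n ≤ ∑ i, (|y i| - 1) := by
          rw [Finset.sum_sub_distrib]
          simpa using norm_le_sum_abs y
      _ ≤ ∑ i, |y i| ^ p := Finset.sum_le_sum fun i _ => by
          rcases le_total |y i| 1 with h | h
          · linarith [Real.rpow_nonneg (abs_nonneg (y i)) p]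
          · linarith [Real.self_le_rpow_of_one_le h hp]
  have h2 := mul_le_mul_of_nonneg_left h1 hCp
  have h3 := (abs_le.1 (abs_sum_mul_cos_le hA fun i => y i / (ℓ i * ε))).1
  have h4 := hlow y
  unfold roughPotential
  linarith

/-- The gradient is tested against the `i`-th basis vector, which sees only the `i`-th cosine. -/
theorem norm_gradient_roughPotential_ge {V₀ : EuclideanSpace ℝ (Fin n) → ℝ}
    (hV₀ : ContDiff ℝ 1 V₀) (A ℓ : Fin n → ℝ) (ε : ℝ) (x : EuclideanSpace ℝ (Fin n)) (i : Fin n) :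
    |A i * Real.sin (x i / (ℓ i * ε)) / (ℓ i * ε)| - ‖gradient V₀ x‖ ≤
      ‖gradient (roughPotential V₀ A ℓ ε) x‖ := by
  set v : EuclideanSpace ℝ (Fin n) := EuclideanSpace.single i 1 with hv
  have hv1 : ‖v‖ = 1 := by simp [hv]
  have h0 : HasFDerivAt V₀ (fderiv ℝ V₀ x) x :=
    (hV₀.differentiable one_ne_zero x).hasFDerivAt
  have h1 : ∀ j, HasFDerivAt (fun z : EuclideanSpace ℝ (Fin n) => A j * Real.cos (z j / (ℓ j * ε)))
      (A j • (-Real.sin (x j / (ℓ j * ε)) • ((ℓ j * ε)⁻¹ •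
        (EuclideanSpace.proj j : EuclideanSpace ℝ (Fin n) →L[ℝ] ℝ)))) x := by
    intro j
    have hp : HasFDerivAt (fun z : EuclideanSpace ℝ (Fin n) => z j / (ℓ j * ε))
        ((ℓ j * ε)⁻¹ • (EuclideanSpace.proj j : EuclideanSpace ℝ (Fin n) →L[ℝ] ℝ)) x := by
      simp only [div_eq_mul_inv]
      exact (EuclideanSpace.proj j : EuclideanSpace ℝ (Fin n) →L[ℝ] ℝ).hasFDerivAt.mul_const _
    exact hp.cos.const_mul (A j)
  have h2 := h0.add (HasFDerivAt.fun_sum (u := Finset.univ) fun j _ => h1 j)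
  have h3 : fderiv ℝ (roughPotential V₀ A ℓ ε) x v =
      fderiv ℝ V₀ x v - A i * Real.sin (x i / (ℓ i * ε)) / (ℓ i * ε) := by
    have : fderiv ℝ (roughPotential V₀ A ℓ ε) x = _ := h2.fderiv
    rw [this]
    simp only [hv, add_apply, sum_apply,
      smul_apply, PiLp.proj_apply, smul_eq_mul]
    rw [Finset.sum_eq_single i]
    · simp
      ring
    · intro j _ hj
      simp [hj]
    · simp
  have h4 : |fderiv ℝ (roughPotential V₀ A ℓ ε) x v| ≤ ‖gradient (roughPotential V₀ A ℓ ε) x‖ := by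
    rw [← inner_gradient_left]
    simpa [hv1] using abs_real_inner_le_norm (gradient (roughPotential V₀ A ℓ ε) x) v
  have h5 : |fderiv ℝ V₀ x v| ≤ ‖gradient V₀ x‖ := by
    rw [← inner_gradient_left]
    simpa [hv1] using abs_real_inner_le_norm (gradient V₀ x) v
  rw [h3] at h4
  have h6 := abs_sub_abs_le_abs_sub (A i * Real.sin (x i / (ℓ i * ε)) / (ℓ i * ε)) (fderiv ℝ V₀ x v)
  rw [abs_sub_comm] at h6
  linarith

/-- A bound for the spectral gap of MALA for a rough potential in terms of the step size `σ`. The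
witness is a point where one coordinate of the gradient of the oscillating part is maximal. -/
theorem spectralGap_mala_roughPotential_le (hn : 1 ≤ n) (F : AcceptanceRule)
    {V₀ : EuclideanSpace ℝ (Fin n) → ℝ} (hV₀ : ContDiff ℝ 1 V₀)
    {Vmin Cp p Amin Amax ℓmax G M : ℝ} (hp : 1 ≤ p) (hCp : 0 < Cp)
    (hlow : ∀ x, Vmin + Cp * ∑ i, |x i| ^ p ≤ V₀ x)
    (hG : ∀ x, ‖x‖ ≤ 1 → ‖gradient V₀ x‖ ≤ G) (hM : ∀ x, ‖x‖ ≤ 1 → V₀ x ≤ M)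
    (hAmin : 0 < Amin) (hℓmax : 0 < ℓmax) {A ℓ : Fin n → ℝ}
    (hA : ∀ i, Amin ≤ |A i| ∧ |A i| ≤ Amax) (hℓ : ∀ i, 0 < ℓ i ∧ ℓ i ≤ ℓmax)
    {ε σ : ℝ} (hε : 0 < ε) (hσ : 0 < σ) (hε1 : Real.pi / 2 * ℓmax * ε < 1)
    (hεG : G < Amin / (2 * ℓmax) / ε) (hεC : 4 * Cp ≤ Amin / (2 * ℓmax) / ε)
    (hεσ : 1 ≤ σ ^ 2 * (Amin / (2 * ℓmax) / ε) / 8) :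
    spectralGap (malaOperator F (roughPotential V₀ A ℓ ε) (measurable_roughPotential hV₀ A ℓ ε) σ) ≤
      2 * ((2 * Real.pi * σ ^ 2) ^ (-(n : ℝ) / 2) *
        Real.exp (|M + n * Cp + 2 * n * Amax - Vmin| + 1 -
          Cp * σ ^ 2 * (Amin / (2 * ℓmax) / ε) / 16) *
        ∫ y : EuclideanSpace ℝ (Fin n), Real.exp (-(Cp / 2 * ‖y‖))) := by
  set i : Fin n := ⟨0, hn⟩
  have hℓi : 0 < ℓ i := (hℓ i).1
  -- Here the sine in the `i`-th coordinate equals `1`.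
  set x₀ : EuclideanSpace ℝ (Fin n) := EuclideanSpace.single i (Real.pi / 2 * (ℓ i * ε)) with hx₀
  have hxn : ‖x₀‖ < 1 := by
    rw [hx₀, PiLp.norm_single, Real.norm_of_nonneg (by positivity)]
    refine lt_of_le_of_lt ?_ hε1
    rw [mul_assoc]
    have := (hℓ i).2
    gcongr
  have hxi : x₀ i / (ℓ i * ε) = Real.pi / 2 := by
    have : ℓ i * ε ≠ 0 := by positivity
    simp [hx₀, this]
  have hgrad := norm_gradient_roughPotential_ge hV₀ A ℓ ε x₀ i
  rw [hxi, Real.sin_pi_div_two, mul_one, abs_div, abs_of_pos (mul_pos hℓi hε)] at hgrad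
  -- The oscillating part provides `2 g`; one `g` absorbs `‖∇V₀‖ ≤ G < g`, the other is the drift
  -- that remains.
  have hAℓ : 2 * (Amin / (2 * ℓmax) / ε) ≤ |A i| / (ℓ i * ε) := by
    calc 2 * (Amin / (2 * ℓmax) / ε) = Amin / (ℓmax * ε) := by field_simp
      _ ≤ |A i| / (ℓ i * ε) := by
        have h1 := (hA i).1
        have h2 := (hℓ i).2
        gcongr
  have hGx := hG x₀ hxn.le
  refine spectralGap_malaOperator_le hn F _ (contDiff_roughPotential hV₀ A ℓ ε) (x₀ := x₀)
    (B := n * Cp + n * Amax - Vmin) hσ hCp (by positivity)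
    (roughPotential_ge hp hCp.le hlow (fun i => (hA i).2) ℓ ε) ?_ hxn hεσ (by linarith) hεC
  -- The cosines count twice, in `V x₀` and in `B`, hence `2 * n * Amax`. In `L`, the absolute value
  -- ensures `0 ≤ L` and the `+ 1` strictness.
  have h1 := (abs_le.1 (abs_sum_mul_cos_le (fun i => (hA i).2) fun i => x₀ i / (ℓ i * ε))).2
  have h2 := hM x₀ hxn.le
  have h3 := le_abs_self (M + n * Cp + 2 * n * Amax - Vmin)
  unfold roughPotential
  linarith

end RoughPotential

/-! ### Asymptotics as `ε → 0⁺` with `σ = ε ^ α`. -/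

section SmallScale

theorem eventually_exp_neg_mul_rpow_le {k s : ℝ} (hk : 0 < k) (hs : 0 < s) (N : ℝ) :
    ∀ᶠ ε : ℝ in 𝓝[>] 0, Real.exp (-(k * ε ^ (-s))) ≤ ε ^ N := by
  have h1 := (tendsto_rpow_mul_exp_neg_mul_atTop_nhds_zero (N / s) k hk).comp
    (tendsto_rpow_neg_nhdsGT_zero (neg_lt_zero.2 hs))
  filter_upwards [h1.eventually_le_const zero_lt_one, self_mem_nhdsWithin] with ε h2 hε
  have hε : 0 < ε := hε
  simp only [Function.comp_apply] at h2
  rw [← Real.rpow_mul hε.le, show -s * (N / s) = -N by field_simp, Real.rpow_neg hε.le,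
    inv_mul_le_iff₀ (Real.rpow_pos_of_pos hε N), mul_one, neg_mul] at h2
  exact h2

/-- The spectral gap of MALA for a rough potential is at most of order `ε ^ (n (2 θ - α))`. -/
theorem exists_eventually_spectralGap_mala_le {n : ℕ} (hn : 1 ≤ n) {p Cp : ℝ} (hp : 1 ≤ p)
    (hCp : 0 < Cp) (F : AcceptanceRule) {V₀ : EuclideanSpace ℝ (Fin n) → ℝ}
    (hV₀ : ContDiff ℝ 1 V₀) {Vmin Amin Amax ℓmin ℓmax α θ : ℝ}
    (hlow : ∀ x, Vmin + Cp * ∑ i, |x i| ^ p ≤ V₀ x) (hα : 0 ≤ α) (hαθ : 2 * α + θ < 1)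
    (hAmin : 0 < Amin) (hℓmin : 0 < ℓmin) :
    ∃ C : ℝ, 0 < C ∧ ∀ᶠ ε : ℝ in 𝓝[>] 0, ∀ A ℓ : Fin n → ℝ,
      (∀ i, Amin ≤ |A i| ∧ |A i| ≤ Amax) → (∀ i, ℓmin ≤ ℓ i ∧ ℓ i ≤ ℓmax) →
      spectralGap (malaOperator F (roughPotential V₀ A ℓ ε)
        (measurable_roughPotential hV₀ A ℓ ε) (ε ^ α)) ≤ C * ε ^ ((n : ℝ) * (2 * θ - α)) := by
  -- For `2θ ≤ α` the power of `ε` is at least `1` when `ε < 1`, so the trivial bound `2` suffices.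
  rcases le_or_gt (2 * θ) α with hθ | hθ
  · refine ⟨2, two_pos, ?_⟩
    filter_upwards [Ioo_mem_nhdsGT zero_lt_one] with ε hε A ℓ _ _
    refine (spectralGap_malaOperator_le_two F _ _).trans ?_
    have : 1 ≤ ε ^ ((n : ℝ) * (2 * θ - α)) :=
      Real.one_le_rpow_of_pos_of_le_one_of_nonpos hε.1 hε.2.le
        (mul_nonpos_of_nonneg_of_nonpos n.cast_nonneg (by linarith))
    linarith
  -- `2θ > α ≥ 0` makes `θ` positive, so `2α < 1`.
  have hs : 0 < 1 - 2 * α := by linarith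
  -- With `ℓmax < ℓmin` no `ℓ` is admissible, since `n ≥ 1`.
  rcases lt_or_ge ℓmax ℓmin with hℓ | hℓ
  · refine ⟨1, one_pos, Filter.Eventually.of_forall fun ε A ℓ _ h => ?_⟩
    have := h ⟨0, hn⟩
    linarith
  have hℓmax : 0 < ℓmax := hℓmin.trans_le hℓ
  have hgc : Continuous (gradient V₀) :=
    (LinearIsometryEquiv.continuous _).comp (hV₀.continuous_fderiv one_ne_zero)
  -- `G` and `M` depend only on `V₀` on the unit ball, which keeps all constants uniform in `A`, `ℓ`
  -- and `ε`.
  obtain ⟨G, hG⟩ := (isCompact_closedBall (0 : EuclideanSpace ℝ (Fin n)) 1).bddAbove_image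
    hgc.norm.continuousOn
  obtain ⟨M, hM⟩ := (isCompact_closedBall (0 : EuclideanSpace ℝ (Fin n)) 1).bddAbove_image
    hV₀.continuous.continuousOn
  have hG' : ∀ x : EuclideanSpace ℝ (Fin n), ‖x‖ ≤ 1 → ‖gradient V₀ x‖ ≤ G := fun x hx =>
    hG ⟨x, by simpa using hx, rfl⟩
  have hM' : ∀ x : EuclideanSpace ℝ (Fin n), ‖x‖ ≤ 1 → V₀ x ≤ M := fun x hx =>
    hM ⟨x, by simpa using hx, rfl⟩
  set a := Amin / (2 * ℓmax) with ha
  have ha0 : 0 < a := by positivity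
  set L := |M + n * Cp + 2 * n * Amax - Vmin| + 1 with hL
  set I := ∫ y : EuclideanSpace ℝ (Fin n), Real.exp (-(Cp / 2 * ‖y‖)) with hI
  have hI0 : 0 ≤ I := integral_nonneg fun y => (Real.exp_pos _).le
  have hinv : Filter.Tendsto (fun ε : ℝ => a / ε) (𝓝[>] 0) Filter.atTop := by
    simp only [div_eq_mul_inv]
    exact tendsto_inv_nhdsGT_zero.const_mul_atTop ha0
  have hpow : Filter.Tendsto (fun ε : ℝ => ε ^ (-(1 - 2 * α))) (𝓝[>] 0) Filter.atTop :=
    tendsto_rpow_neg_nhdsGT_zero (neg_lt_zero.2 hs)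
  have hsmall : ∀ᶠ ε : ℝ in 𝓝[>] 0, Real.pi / 2 * ℓmax * ε < 1 := by
    have : Filter.Tendsto (fun ε : ℝ => Real.pi / 2 * ℓmax * ε) (𝓝[>] 0)
        (𝓝 (Real.pi / 2 * ℓmax * 0)) :=
      ((continuous_const.mul continuous_id).tendsto 0).mono_left nhdsWithin_le_nhds
    exact this.eventually_lt_const (by simp)
  refine ⟨2 * (2 * Real.pi) ^ (-(n : ℝ) / 2) * Real.exp L * (I + 1), by positivity, ?_⟩
  filter_upwards [self_mem_nhdsWithin, hsmall, hinv.eventually_gt_atTop G,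
    hinv.eventually_ge_atTop (4 * Cp), hpow.eventually_ge_atTop (8 / a),
    -- Any power is available; `2 n θ` is the one that, multiplied by the prefactor `ε ^ (-(n α))`,
    -- gives exactly the target power.
    eventually_exp_neg_mul_rpow_le (k := Cp * a / 16) (by positivity) hs (2 * n * θ)]
    with ε hε h1 h2 h3 h4 h5 A ℓ hA hℓi
  have hε : 0 < ε := hε
  have hsq : (ε ^ α) ^ 2 = ε ^ (2 * α) := by
    rw [← Real.rpow_natCast, ← Real.rpow_mul hε.le]
    congr 1
    push_cast
    ring
  have hscale : (ε ^ α) ^ 2 * (a / ε) = a * ε ^ (-(1 - 2 * α)) := by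
    rw [hsq, neg_sub, Real.rpow_sub_one hε.ne']
    ring
  have h6 : 1 ≤ (ε ^ α) ^ 2 * (a / ε) / 8 := by
    rw [hscale]
    rw [div_le_iff₀ ha0] at h4
    linarith
  refine (spectralGap_mala_roughPotential_le hn F hV₀ hp hCp hlow hG' hM' hAmin hℓmax hA
    (fun i => ⟨hℓmin.trans_le (hℓi i).1, (hℓi i).2⟩) hε (Real.rpow_pos_of_pos hε α) h1 h2 h3
    h6).trans ?_
  have h7 : Real.exp (L - Cp * (ε ^ α) ^ 2 * (a / ε) / 16) ≤ Real.exp L * ε ^ (2 * n * θ) := by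
    have e : L - Cp * (ε ^ α) ^ 2 * (a / ε) / 16 = L + -(Cp * a / 16 * ε ^ (-(1 - 2 * α))) := by
      rw [mul_assoc Cp, hscale]
      ring
    rw [e, Real.exp_add]
    exact mul_le_mul_of_nonneg_left h5 (Real.exp_pos L).le
  have h8 : (2 * Real.pi * (ε ^ α) ^ 2) ^ (-(n : ℝ) / 2) =
      (2 * Real.pi) ^ (-(n : ℝ) / 2) * ε ^ (-(n * α)) := by
    rw [hsq, Real.mul_rpow (by positivity) (by positivity), ← Real.rpow_mul hε.le]
    congr 2
    ring
  have h9 : ε ^ ((n : ℝ) * (2 * θ - α)) = ε ^ (-(n * α)) * ε ^ (2 * n * θ) := by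
    rw [← Real.rpow_add hε]
    congr 1
    ring
  rw [h8, h9]
  calc 2 * ((2 * Real.pi) ^ (-(n : ℝ) / 2) * ε ^ (-(n * α)) *
        Real.exp (L - Cp * (ε ^ α) ^ 2 * (a / ε) / 16) * I)
      ≤ 2 * ((2 * Real.pi) ^ (-(n : ℝ) / 2) * ε ^ (-(n * α)) *
        (Real.exp L * ε ^ (2 * n * θ)) * (I + 1)) := by
        gcongr
        linarith
    _ = _ := by ring

end SmallScale

/-! ### The gap bound and its limit. -/

theorem theorem2p10 (n : ℕ) (hn : 1 ≤ n) (p Cp : ℝ) (hp : 1 ≤ p) (hCp : 0 < Cp) :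
    ∃ κ : ℝ, 0 < κ ∧
      ∀ (F : AcceptanceRule) (V₀ : EuclideanSpace ℝ (Fin n) → ℝ) (hV₀ : ContDiff ℝ 1 V₀)
        (Vmin D₀ D₁ δ α γ θ Amin Amax ℓmin ℓmax : ℝ),
        (∀ x, Vmin + Cp * ∑ i, |x i| ^ p ≤ V₀ x) →
        0 < δ → (∀ x, ‖gradient V₀ x‖ ≤ D₀ + D₁ * ‖x‖ ^ δ) →
        0 ≤ α → 0 < γ → 2 * α + δ * γ + θ < 1 →
        0 < Amin → 0 < ℓmin →
        (∃ C ε₀ : ℝ, 0 < C ∧ 0 < ε₀ ∧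
          ∀ ε : ℝ, 0 < ε → ε < ε₀ → ∀ A ℓ : Fin n → ℝ,
            (∀ i, Amin ≤ |A i| ∧ |A i| ≤ Amax) → (∀ i, ℓmin ≤ ℓ i ∧ ℓ i ≤ ℓmax) →
            spectralGap (malaOperator F (roughPotential V₀ A ℓ ε)
                (measurable_roughPotential hV₀ A ℓ ε) (ε ^ α)) ≤
              C * (Real.exp (-(1 / 2) * κ * ε ^ (-(γ * p))) +
                Real.exp (-(1 / 32) * ε ^ (-2 * (1 - α - θ))) +
                ε ^ ((n : ℝ) * (2 * θ - α)))) ∧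
        (α < 2 * θ → ∀ A ℓ : Fin n → ℝ,
          (∀ i, Amin ≤ |A i| ∧ |A i| ≤ Amax) → (∀ i, ℓmin ≤ ℓ i ∧ ℓ i ≤ ℓmax) →
          Filter.Tendsto
            (fun ε : ℝ => spectralGap (malaOperator F (roughPotential V₀ A ℓ ε)
              (measurable_roughPotential hV₀ A ℓ ε) (ε ^ α)))
            (𝓝[>] 0) (𝓝 0)) := by

  -- Any positive `κ` would do: its exponential is only added as a nonnegative term.
  refine ⟨1, one_pos, ?_⟩
  intro F V₀ hV₀ Vmin D₀ D₁ δ α γ θ Amin Amax ℓmin ℓmax hlow hδ _ hα hγ hexp hAmin hℓmin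
  have hαθ : 2 * α + θ < 1 := by
    have := mul_pos hδ hγ
    linarith
  obtain ⟨C, hC, hbound⟩ := exists_eventually_spectralGap_mala_le (Amax := Amax) (ℓmax := ℓmax)
    hn hp hCp F hV₀ hlow hα hαθ hAmin hℓmin
  refine ⟨?_, fun hθ A ℓ hA hℓ => ?_⟩
  · obtain ⟨ε₀, hε₀, hsub⟩ := mem_nhdsGT_iff_exists_Ioo_subset.1 hbound
    refine ⟨C, ε₀, hC, hε₀, fun ε h0 h1 A ℓ hA hℓ => (hsub ⟨h0, h1⟩ A ℓ hA hℓ).trans ?_⟩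
    refine mul_le_mul_of_nonneg_left ?_ hC.le
    linarith [Real.exp_pos (-(1 / 2) * 1 * ε ^ (-(γ * p))),
      Real.exp_pos (-(1 / 32) * ε ^ (-2 * (1 - α - θ)))]
  · have hpos : 0 < (n : ℝ) * (2 * θ - α) :=
      mul_pos (by exact_mod_cast hn) (by linarith)
    have hlim : Filter.Tendsto (fun ε : ℝ => C * ε ^ ((n : ℝ) * (2 * θ - α))) (𝓝[>] 0) (𝓝 0) := by
      have := (((Real.continuous_rpow_const hpos.le).tendsto 0).const_mul C).mono_left
        (nhdsWithin_le_nhds (s := Set.Ioi 0))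
      simpa [Real.zero_rpow hpos.ne'] using this
    refine tendsto_of_tendsto_of_tendsto_of_le_of_le' tendsto_const_nhds hlim
      (Filter.Eventually.of_forall fun ε => spectralGap_malaOperator_nonneg F _ _) ?_
    filter_upwards [hbound] with ε h
    exact h A ℓ hA hℓ
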